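/- Let $b\ge 1$ and $n\ge 1$ be integers. In the $b$-biased Maker--Breaker game on $E(K_n)$, two players, Maker and Breaker, alternately claim free (that is, not yet claimed) edges of the complete graph $K_n$ on $n$ vertices, Maker moving first, until all edges are claimed. In each round Maker claims exactly one free edge, and then Breaker claims exactly $b$ free edges (or all remaining free edges, if fewer than $b$ remain). Maker's graph is the graph on the vertex set of $K_n$ formed by the edges claimed by Maker. Theorem. For every $\epsilon>0$ there exist $c>0$ and $n_0$ such that for all integers $n\ge n_0$ and all integers $b$ with $1\le b\le (1-\epsilon)\frac{n}{2}$, in the $b$-biased Maker--Breaker game on $E(K_n)$ Maker has a strategy which guarantees, however Breaker plays, that Maker's graph at the end of the game contains a cycle of length at least $cn$. -/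

import Mathlib

namespace MakerBreaker

/-- A position of a Maker-Breaker game on the edge set of the complete graph on `V`:
the edges claimed so far by each of the two players. -/
structure Position (V : Type*) where
  maker : Finset (Sym2 V)
  breaker : Finset (Sym2 V)

variable {V : Type*} [Fintype V] [DecidableEq V]

/-- The initial position: nothing has been claimed. -/
def Position.initial : Position V := ⟨∅, ∅⟩

/-- The free edges of the complete graph on `V`: those claimed by neither player. -/
def Position.free (P : Position V) : Finset (Sym2 V) :=
  (⊤ : SimpleGraph V).edgeFinset \ (P.maker ∪ P.breaker)

/-- The graph of Maker's edges. -/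
def Position.makerGraph (P : Position V) : SimpleGraph V :=
  SimpleGraph.fromEdgeSet (P.maker : Set (Sym2 V))

/-- The position after Maker claims the edge `e`. -/
def Position.makerMove (P : Position V) (e : Sym2 V) : Position V :=
  ⟨insert e P.maker, P.breaker⟩

/-- The position after Breaker claims all edges in `R`. -/
def Position.breakerMove (P : Position V) (R : Finset (Sym2 V)) : Position V :=
  ⟨P.maker, P.breaker ∪ R⟩

/-- A legal move of Breaker with bias `b`: exactly `b` free edges, or all the free edges if
fewer than `b` are left. -/
def Position.IsBreakerMove (b : ℕ) (P : Position V) (R : Finset (Sym2 V)) : Prop :=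
  R ⊆ P.free ∧ R.card = min b P.free.card

/-- `Reachable b S P`: the position `P`, with Maker to move (or with the game over), arises when
Maker moves first and claims in each round the edge that `S` assigns to the current position,
while Breaker answers each time by an arbitrary legal move with bias `b`. -/
inductive Reachable (b : ℕ) (S : Position V → Sym2 V) : Position V → Prop
  | initial : Reachable b S Position.initial
  | round (P : Position V) (R : Finset (Sym2 V)) :
      Reachable b S P → P.free.Nonempty → (P.makerMove (S P)).IsBreakerMove b R →
      Reachable b S ((P.makerMove (S P)).breakerMove R)

/-- `S` is a winning strategy for Maker in the `b`-biased game with target property `Q`: as long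
as the game is not over it tells Maker to claim a free edge, and however Breaker plays, Maker's
graph has the property `Q` when all edges have been claimed. -/
def IsWinningStrategy (b : ℕ) (Q : SimpleGraph V → Prop) (S : Position V → Sym2 V) : Prop :=
  ∀ P : Position V, Reachable b S P →
    (P.free.Nonempty → S P ∈ P.free) ∧ (P.free = ∅ → Q P.makerGraph)

/-- Maker has a winning strategy in the `b`-biased Maker-Breaker game on the edge set of the
complete graph on `V` with target property `Q`. -/
def MakerWins (b : ℕ) (Q : SimpleGraph V → Prop) : Prop :=
  ∃ S : Position V → Sym2 V, IsWinningStrategy b Q S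

/-- The graph `G` contains a cycle of length at least `ℓ`. -/
def HasCycleOfLengthAtLeast (ℓ : ℝ) (G : SimpleGraph V) : Prop :=
  ∃ (v : V) (p : G.Walk v v), p.IsCycle ∧ ℓ ≤ (p.length : ℝ)

end MakerBreaker

/-! Maker only needs her first `T`, about (1 + ε/2)n, edges. While she claims them, the bias leaves
at least `D` = εn²/8 edges free, so the free edges at each turn are numerous enough for her to
imitate a random choice deterministically. By a first moment bound, `T` random edges would be
expected to contain fewer than one of the configurations "a set `W` of at most αn vertices spanning
more than (1 + ε/8)|W| edges". A conditional expectation potential lets Maker avoid all of them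
(`exists_danger_insert_le`, `sum_denseSets_pow_lt_one`). Breaker enters only through the number of
free edges.

Her graph then has density above 1 + ε/4 globally, but at most 1 + ε/8 on small sets. Such a graph
has a linear cycle (`exists_cycle_of_locally_sparse`). In a minimal vertex set of density above 1 +
ε/4, a depth-first search yields a set `W` of linear size whose outside neighbours all lie on one
path that can be closed up through `W`. Either there are many neighbours and the cycle is long, or
there are few and deleting `W` removes too few edges, contradicting minimality. -/

namespace MakerBreaker

/-! ### Long cycles in locally sparse graphs, by depth-first search. -/

section LongCycles

variable {V : Type*}

/-- A set `U` of vertices hanging from a path: all neighbours of `U` in `X` lie on the path, and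
every union of components of `U` is adjacent to the last vertex of the path. -/
def HangsFromPath (G : SimpleGraph V) (X U : Set V) : Prop :=
  ∃ (a v : V) (p : G.Walk a v), p.IsPath ∧ U ⊆ X ∧ (∀ x ∈ U, x ∉ p.support) ∧
    (∀ x ∈ X \ U, ∀ u ∈ U, G.Adj u x → x ∈ p.support) ∧
    ∀ A ⊆ U, A.Nonempty → (∀ a ∈ A, ∀ b ∈ U \ A, ¬ G.Adj a b) → ∃ a ∈ A, G.Adj v a

theorem HangsFromPath.of_union {G : SimpleGraph V} {X U A : Set V} (h : HangsFromPath G X U)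
    (hA : A ⊆ U) (hc : ∀ a ∈ A, ∀ b ∈ U \ A, ¬ G.Adj a b) : HangsFromPath G X A := by
  obtain ⟨a, v, p, hp, hUX, hd, hN, hatt⟩ := h
  refine ⟨a, v, p, hp, hA.trans hUX, fun x hx => hd x (hA hx), ?_, ?_⟩
  · rintro x ⟨hxX, hxA⟩ u hu huv
    by_cases hxU : x ∈ U
    · exact absurd huv (hc u hu x ⟨hxU, hxA⟩)
    · exact hN x ⟨hxX, hxU⟩ u (hA hu) huv
  · intro B hB hne hcB
    refine hatt B (hB.trans hA) hne ?_
    rintro b hb y ⟨hyU, hyB⟩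
    by_cases hyA : y ∈ A
    · exact hcB b hb y ⟨hyA, hyB⟩
    · exact hc b (hB hb) y ⟨hyU, hyA⟩

/-- The search advances: the path is extended to a neighbour `u` of its end in `U`. As `U` is
connected, every union of components of what remains sends an edge to `u`, the new end. -/
theorem HangsFromPath.exists_diff_singleton {G : SimpleGraph V} {X U : Set V}
    (h : HangsFromPath G X U) (hne : U.Nonempty)
    (hconn : ∀ A ⊆ U, A.Nonempty → A ≠ U → ∃ a ∈ A, ∃ b ∈ U \ A, G.Adj a b) :
    ∃ u ∈ U, HangsFromPath G X (U \ {u}) := by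
  obtain ⟨a, v, p, hp, hUX, hd, hN, hatt⟩ := h
  obtain ⟨u, huU, huv⟩ := hatt U subset_rfl hne (by simp)
  refine ⟨u, huU, a, u, p.concat huv, hp.concat (hd u huU) huv, fun x hx => hUX hx.1, ?_, ?_, ?_⟩
  · rintro x ⟨hxU, hxu⟩
    simp only [SimpleGraph.Walk.support_concat, List.mem_append, List.mem_singleton]
    rintro (h | h)
    · exact hd x hxU h
    · exact hxu h
  · rintro x ⟨hxX, hx⟩ w hw hadj
    simp only [SimpleGraph.Walk.support_concat, List.mem_append, List.mem_singleton]
    by_cases hxu : x = u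
    · exact Or.inr hxu
    · exact Or.inl (hN x ⟨hxX, fun hxU => hx ⟨hxU, hxu⟩⟩ w hw.1 hadj)
  · intro A hA hAne hc
    have hAU : A ≠ U := fun hAU => (hA (hAU ▸ huU)).2 rfl
    obtain ⟨x, hx, y, ⟨hyU, hyA⟩, hxy⟩ := hconn A (fun z hz => (hA hz).1) hAne hAU
    by_cases hyu : y = u
    · exact ⟨x, hx, hyu ▸ hxy.symm⟩
    · exact absurd hxy (hc x hx y ⟨⟨hyU, hyu⟩, hyA⟩)

/-- A connected `U` loses one vertex to the path; a disconnected one is split and a side with at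
least `s` vertices is kept. Such a side exists while |U| > 2s, so the shrinking set cannot jump over
the interval [s, 2s]. -/
theorem HangsFromPath.exists_card_le [DecidableEq V] {G : SimpleGraph V} {X : Set V} {s : ℕ}
    (hs : 1 ≤ s) (U : Finset V) (h : HangsFromPath G X U) (hsU : s ≤ U.card) :
    ∃ W : Finset V, HangsFromPath G X W ∧ s ≤ W.card ∧ W.card ≤ 2 * s := by
  induction U using Finset.strongInduction with
  | H U ih =>
    by_cases hle : U.card ≤ 2 * s
    · exact ⟨U, h, hsU, hle⟩
    by_cases hconn : ∀ A ⊆ (U : Set V), A.Nonempty → A ≠ U →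
        ∃ a ∈ A, ∃ b ∈ (U : Set V) \ A, G.Adj a b
    · have hUne : U.Nonempty := Finset.card_pos.1 (by omega)
      obtain ⟨u, hu, hU⟩ := h.exists_diff_singleton (by exact_mod_cast hUne) hconn
      have hcard := Finset.card_erase_of_mem (Finset.mem_coe.1 hu)
      exact ih (U.erase u) (Finset.erase_ssubset (Finset.mem_coe.1 hu))
        (by rwa [Finset.coe_erase]) (by omega)
    · push Not at hconn
      obtain ⟨A, hA, hAne, hAU, hc⟩ := hconn
      obtain ⟨A, rfl⟩ := (U.finite_toSet.subset hA).exists_finset_coe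
      rw [Finset.coe_subset] at hA
      have hAU' : A ≠ U := fun h => hAU (by rw [h])
      have hsum := Finset.card_sdiff_add_card_eq_card hA
      by_cases hsA : s ≤ A.card
      · exact ih A (hA.ssubset_of_ne hAU') (h.of_union (Finset.coe_subset.2 hA) hc) hsA
      · refine ih (U \ A) ?_ (h.of_union (by simp) ?_) (by omega)
        · exact Finset.sdiff_ssubset hA (by exact_mod_cast hAne)
        · rintro a ha b ⟨hbU, hb⟩ hab
          have hbA : b ∈ (A : Set V) := by
            by_contra hbA
            exact hb (by simpa using ⟨hbU, hbA⟩)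
          exact hc b hbA a (by simpa using ha) hab.symm

theorem exists_path_from_mem {G : SimpleGraph V} {N : Set V} (hN : N.Nonempty) {a v : V}
    (p : G.Walk a v) (hp : p.IsPath) (hNp : ∀ x ∈ N, x ∈ p.support) :
    ∃ w ∈ N, ∃ q : G.Walk w v, q.IsPath ∧ (∀ x ∈ N, x ∈ q.support) ∧
      ∀ x ∈ q.support, x ∈ p.support := by
  induction p with
  | nil =>
    obtain ⟨x, hx⟩ := hN
    have := hNp x hx
    simp only [SimpleGraph.Walk.support_nil, List.mem_singleton] at this
    subst this
    exact ⟨x, hx, .nil, hp, hNp, fun _ h => h⟩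
  | @cons a b c h p ih =>
    by_cases ha : a ∈ N
    · exact ⟨a, ha, _, hp, hNp, fun _ h => h⟩
    · obtain ⟨w, hw, q, hq, hNq, hqp⟩ := ih hp.of_cons (fun x hx => by
        have := hNp x hx
        rw [SimpleGraph.Walk.support_cons, List.mem_cons] at this
        exact this.resolve_left (fun hxa => ha (hxa ▸ hx)))
      exact ⟨w, hw, q, hq, hNq, fun x hx => by
        rw [SimpleGraph.Walk.support_cons]; exact List.mem_cons_of_mem _ (hqp x hx)⟩

theorem exists_cycle_of_two_paths {G : SimpleGraph V} {w v x y : V} (q : G.Walk w v)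
    (r : G.Walk y x) (hq : q.IsPath) (hr : r.IsPath) (hdisj : ∀ z ∈ r.support, z ∉ q.support)
    (hwv : w ≠ v) (hxw : G.Adj x w) (hvy : G.Adj v y) :
    ∃ p : G.Walk v v, p.IsCycle ∧ q.length + 2 ≤ p.length := by
  have hpath : (r.append (.cons hxw q)).IsPath := by
    rw [SimpleGraph.Walk.isPath_def, SimpleGraph.Walk.support_append,
      SimpleGraph.Walk.support_cons, List.tail_cons, List.nodup_append]
    exact ⟨hr.support_nodup, hq.support_nodup, fun a ha b hb hab => hdisj a ha (hab ▸ hb)⟩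
  refine ⟨.cons hvy (r.append (.cons hxw q)), ?_, ?_⟩
  · rw [SimpleGraph.Walk.cons_isCycle_iff]
    refine ⟨hpath, ?_⟩
    rw [SimpleGraph.Walk.edges_append, SimpleGraph.Walk.edges_cons]
    simp only [List.mem_append, List.mem_cons, not_or]
    refine ⟨fun h => ?_, fun h => ?_, fun h => ?_⟩
    · exact hdisj v (r.fst_mem_support_of_mem_edges h) q.end_mem_support
    · rcases Sym2.eq_iff.1 h with ⟨h1, -⟩ | ⟨h1, -⟩
      · exact hdisj x r.end_mem_support (h1 ▸ q.end_mem_support)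
      · exact hwv h1.symm
    · exact hdisj y r.start_mem_support (q.snd_mem_support_of_mem_edges h)
  · simp only [SimpleGraph.Walk.length_cons, SimpleGraph.Walk.length_append]
    omega

/-- The final segment of the path, starting at its first vertex in `N`, contains all of `N`. It
closes to a cycle through a component of `W` adjacent to both of its ends. -/
theorem HangsFromPath.exists_cycle [DecidableEq V] {G : SimpleGraph V} {X W : Set V}
    (h : HangsFromPath G X W) (N : Finset V)
    (hN : ∀ x ∈ N, x ∈ X \ W ∧ ∃ u ∈ W, G.Adj u x) (hcard : 1 < N.card) :
    ∃ (v : V) (p : G.Walk v v), p.IsCycle ∧ N.card + 1 ≤ p.length := by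
  obtain ⟨a, v, p, hp, hUX, hd, hNp, hatt⟩ := h
  have hNne : (N : Set V).Nonempty := by
    exact_mod_cast Finset.card_pos.1 (by omega : 0 < N.card)
  obtain ⟨w, hw, q, hq, hNq, hqp⟩ := exists_path_from_mem hNne p hp (fun x hx => by
    obtain ⟨hx1, u, hu, hux⟩ := hN x hx
    exact hNp x hx1 u hu hux)
  obtain ⟨-, x, hxW, hxw⟩ := hN w hw
  -- This set is the component of `x` in `W`, so it contains a neighbour of `v`.
  obtain ⟨y, ⟨hyW, r, hr⟩, hvy⟩ := hatt {y | y ∈ W ∧ ∃ r : G.Walk y x, ∀ z ∈ r.support, z ∈ W}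
    (fun y hy => hy.1) ⟨x, hxW, .nil, by simpa using hxW⟩ (by
      rintro b ⟨hb, r, hr⟩ c ⟨hc, hc'⟩ hbc
      refine hc' ⟨hc, .cons hbc.symm r, ?_⟩
      intro z hz
      rw [SimpleGraph.Walk.support_cons, List.mem_cons] at hz
      rcases hz with rfl | hz
      · exact hc
      · exact hr z hz)
  have hlen : N.card ≤ q.length + 1 := by
    rw [← SimpleGraph.Walk.length_support]
    refine le_trans (Finset.card_le_card (t := q.support.toFinset) ?_) (List.toFinset_card_le _)
    intro z hz
    exact List.mem_toFinset.2 (hNq z hz)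
  have hwv : w ≠ v := by
    rintro rfl
    have : q.length = 0 := by
      exact (SimpleGraph.Walk.isPath_iff_nil.1 hq).length_eq_zero
    omega
  obtain ⟨c, hc, hcl⟩ := exists_cycle_of_two_paths q r.bypass hq r.bypass_isPath
    (fun z hz hzq => hd z (hr z (r.support_bypass_subset_support hz)) (hqp z hzq)) hwv hxw hvy
  exact ⟨v, c, hc, by omega⟩

/-- In a connected vertex set `X` there is a set of between `s` and `2 * s` vertices such that some
cycle is longer than the number of its neighbours. -/
theorem exists_small_neighborhood_or_cycle [DecidableEq V] {G : SimpleGraph V} {X : Finset V}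
    (hconn : ∀ A ⊆ X, A.Nonempty → A ≠ X → ∃ a ∈ A, ∃ b ∈ X \ A, G.Adj a b) {s : ℕ}
    (hs : 1 ≤ s) (hsX : s < X.card) :
    ∃ W ⊆ X, s ≤ W.card ∧ W.card ≤ 2 * s ∧ ∀ N : Finset V,
      (∀ x ∈ N, x ∈ X \ W ∧ ∃ u ∈ W, G.Adj u x) → 1 < N.card →
      ∃ (v : V) (p : G.Walk v v), p.IsCycle ∧ N.card + 1 ≤ p.length := by
  obtain ⟨u, hu⟩ := Finset.card_pos.1 (by omega : 0 < X.card)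
  have hcard := Finset.card_erase_of_mem hu
  have hstart : HangsFromPath G X (X.erase u : Finset V) := by
    refine ⟨u, u, .nil, .nil, by simp, by simp, ?_, ?_⟩
    · rintro x ⟨hx, hx'⟩ - - -
      by_contra h
      exact hx' (Finset.mem_coe.2 (Finset.mem_erase.2 ⟨by simpa using h, hx⟩))
    · intro A hA hne hc
      obtain ⟨A, rfl⟩ := ((X.erase u).finite_toSet.subset hA).exists_finset_coe
      rw [Finset.coe_subset] at hA
      obtain ⟨a, ha, b, hb, hab⟩ := hconn A (hA.trans (Finset.erase_subset _ _))
        (by exact_mod_cast hne) (fun h => absurd (hA (h ▸ hu)) (by simp))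
      rw [Finset.mem_sdiff] at hb
      by_cases hbu : b = u
      · exact ⟨a, ha, hbu ▸ hab.symm⟩
      · exact absurd hab (hc a ha b (by simpa [hbu] using hb))
  obtain ⟨W, hW, h1, h2⟩ := HangsFromPath.exists_card_le hs _ hstart (by omega)
  refine ⟨W, ?_, h1, h2, fun N hN hc => hW.exists_cycle N (by simpa using hN) hc⟩
  obtain ⟨_, _, _, _, h, _⟩ := hW
  exact_mod_cast h

/-- A graph which is denser than its small subgraphs contains a long cycle. -/
theorem exists_cycle_of_locally_sparse [Fintype V] [DecidableEq V] {M : Finset (Sym2 V)}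
    {β γ m ℓ : ℝ} {s : ℕ} (hβ : 0 ≤ β) (hβγ : β ≤ γ)
    (hsparse : ∀ W : Finset V, (W.card : ℝ) ≤ m → ((M ∩ W.sym2).card : ℝ) ≤ β * W.card)
    (hs : 1 ≤ s) (hsm : (s : ℝ) ≤ m) (hm : 2 * (s : ℝ) + ℓ ≤ m) (hℓ : 1 ≤ ℓ)
    (hβℓ : β * ℓ ≤ (γ - β) * s) (hM : γ * Fintype.card V < M.card) :
    ∃ (v : V) (p : (SimpleGraph.fromEdgeSet (M : Set (Sym2 V))).Walk v v),
      p.IsCycle ∧ ℓ ≤ p.length := by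
  by_contra! hno
  suffices H : ∀ X : Finset V, ((M ∩ X.sym2).card : ℝ) ≤ γ * X.card by
    have := H Finset.univ
    rw [Finset.sym2_univ, Finset.inter_univ, Finset.card_univ] at this
    linarith
  intro X
  induction X using Finset.strongInduction with
  | H X ih =>
    by_contra! hX
    have hXm : m < X.card := by
      by_contra! h
      have := hsparse X h
      have h2 : β * (X.card : ℝ) ≤ γ * X.card := by gcongr
      linarith
    -- A minimal `X` with more than γ|X| edges is connected: otherwise one side of a split would
    -- already be too dense.
    have hconn : ∀ A ⊆ X, A.Nonempty → A ≠ X → ∃ a ∈ A, ∃ b ∈ X \ A,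
        (SimpleGraph.fromEdgeSet (M : Set (Sym2 V))).Adj a b := by
      intro A hA hne hAX
      by_contra! hc
      have h1 := ih A (hA.ssubset_of_ne hAX)
      have h2 := ih (X \ A) (Finset.sdiff_ssubset hA hne)
      have h3 : M ∩ X.sym2 ⊆ (M ∩ A.sym2) ∪ (M ∩ (X \ A).sym2) := by
        intro e
        induction e using Sym2.ind with
        | h a b =>
          simp only [Finset.mem_inter, Finset.mem_union, Finset.mk_mem_sym2_iff, Finset.mem_sdiff]
          rintro ⟨he, ha, hb⟩
          by_cases haA : a ∈ A <;> by_cases hbA : b ∈ A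
          · exact Or.inl ⟨he, haA, hbA⟩
          · refine absurd ?_ (hc a haA b (by simp [hb, hbA]))
            rw [SimpleGraph.fromEdgeSet_adj]
            exact ⟨he, fun h => hbA (h ▸ haA)⟩
          · refine absurd ?_ (hc b hbA a (by simp [ha, haA]))
            rw [SimpleGraph.fromEdgeSet_adj, Sym2.eq_swap]
            exact ⟨he, fun h => haA (h ▸ hbA)⟩
          · exact Or.inr ⟨he, ⟨ha, haA⟩, hb, hbA⟩
      have h4 : ((M ∩ X.sym2).card : ℝ) ≤ (M ∩ A.sym2).card + (M ∩ (X \ A).sym2).card := by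
        exact_mod_cast (Finset.card_le_card h3).trans (Finset.card_union_le _ _)
      have h5 : ((X \ A).card : ℝ) + A.card = X.card := by
        exact_mod_cast Finset.card_sdiff_add_card_eq_card hA
      rw [← h5] at hX
      linarith
    obtain ⟨W, hWX, hsW, hWs, hcyc⟩ := exists_small_neighborhood_or_cycle hconn hs
      (by exact_mod_cast lt_of_le_of_lt hsm hXm)
    classical
    set N : Finset V := (X \ W).filter
      (fun x => ∃ u ∈ W, (SimpleGraph.fromEdgeSet (M : Set (Sym2 V))).Adj u x) with hNdef
    have hN : (N.card : ℝ) ≤ ℓ := by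
      by_contra! h
      have h1 : 1 < N.card := by exact_mod_cast hℓ.trans_lt h
      obtain ⟨v, p, hp, hpl⟩ := hcyc N (fun x hx => Finset.mem_filter.1 hx) h1
      have h2 := hno v p hp
      have h3 : ((N.card + 1 : ℕ) : ℝ) ≤ p.length := by exact_mod_cast hpl
      push_cast at h3
      linarith
    -- Every edge lost by deleting `W` lies inside `W ∪ N`, a set of at most `m` vertices. Sparsity
    -- bounds the loss by β(|W| + ℓ) ≤ γ|W|, so `X \ W` would still be too dense.
    have hcover : M ∩ X.sym2 ⊆ (M ∩ (X \ W).sym2) ∪ (M ∩ (W ∪ N).sym2) := by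
      intro e
      induction e using Sym2.ind with
      | h a b =>
        simp only [Finset.mem_inter, Finset.mem_union, Finset.mk_mem_sym2_iff, Finset.mem_sdiff]
        rintro ⟨he, ha, hb⟩
        by_cases haA : a ∈ W <;> by_cases hbA : b ∈ W
        · exact Or.inr ⟨he, Or.inl haA, Or.inl hbA⟩
        · refine Or.inr ⟨he, Or.inl haA, Or.inr ?_⟩
          rw [hNdef, Finset.mem_filter, Finset.mem_sdiff]
          refine ⟨⟨hb, hbA⟩, a, haA, ?_⟩
          rw [SimpleGraph.fromEdgeSet_adj]
          exact ⟨he, fun h => hbA (h ▸ haA)⟩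
        · refine Or.inr ⟨he, Or.inr ?_, Or.inl hbA⟩
          rw [hNdef, Finset.mem_filter, Finset.mem_sdiff]
          refine ⟨⟨ha, haA⟩, b, hbA, ?_⟩
          rw [SimpleGraph.fromEdgeSet_adj, Sym2.eq_swap]
          exact ⟨he, fun h => haA (h ▸ hbA)⟩
        · exact Or.inl ⟨he, ⟨ha, haA⟩, hb, hbA⟩
    have h4 : ((M ∩ X.sym2).card : ℝ) ≤ (M ∩ (X \ W).sym2).card + (M ∩ (W ∪ N).sym2).card := by
      exact_mod_cast (Finset.card_le_card hcover).trans (Finset.card_union_le _ _)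
    have h5 : ((X \ W).card : ℝ) + W.card = X.card := by
      exact_mod_cast Finset.card_sdiff_add_card_eq_card hWX
    have h6 : ((W ∪ N).card : ℝ) ≤ W.card + N.card := by
      exact_mod_cast Finset.card_union_le W N
    have hWs' : (W.card : ℝ) ≤ 2 * s := by exact_mod_cast hWs
    have hsW' : (s : ℝ) ≤ W.card := by exact_mod_cast hsW
    have h7 := hsparse (W ∪ N) (by linarith)
    have h8 : β * ((W ∪ N).card : ℝ) ≤ β * (W.card + ℓ) := by gcongr; linarith
    have h9 : (γ - β) * (s : ℝ) ≤ (γ - β) * W.card := by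
      have : 0 ≤ γ - β := by linarith
      gcongr
    have h10 := ih (X \ W) (Finset.sdiff_ssubset hWX (Finset.card_pos.1 (by omega)))
    rw [← h5] at hX
    linarith

end LongCycles

/-! ### The conditional expectation potential. -/

section Potential

variable {V : Type*} [DecidableEq V]

/-- The expected number of members of `𝓕` that Maker will own after `T` rounds, if each of her
remaining edges hits every given edge with probability `1 / D`. -/
noncomputable def danger (𝓕 : Finset (Finset (Sym2 V))) (D : ℝ) (T : ℕ)
    (M : Finset (Sym2 V)) : ℝ :=
  ∑ F ∈ 𝓕, (((T : ℝ) - M.card) / D) ^ (F \ M).card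

/-- At most `j = |F \ M|` edges of `E` lie in `F`, and each of them lowers the exponent by one. The
average over at least `D` edges is thus at most the first two binomial terms of (p + 1/D)^j. -/
theorem sum_pow_card_sdiff_insert_le {D p : ℝ} (hD : 0 < D) (hp : 0 ≤ p) {E M : Finset (Sym2 V)}
    (hE : Disjoint E M) (hDE : D ≤ E.card) (F : Finset (Sym2 V)) :
    ∑ e ∈ E, p ^ (F \ insert e M).card ≤ E.card * (p + 1 / D) ^ (F \ M).card := by
  have hcard : ∀ e ∈ E, (F \ insert e M).card = (F \ M).card - if e ∈ F then 1 else 0 := by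
    intro e he
    have heM : e ∉ M := Finset.disjoint_left.1 hE he
    rw [Finset.sdiff_insert]
    split_ifs with heF
    · rw [Finset.card_erase_of_mem (by simp [heF, heM])]
    · rw [Finset.erase_eq_of_notMem (by simp [heF])]; rfl
  set j := (F \ M).card with hj
  have hterm : ∀ e ∈ E, p ^ (F \ insert e M).card ≤
      p ^ j + if e ∈ F then p ^ (j - 1) else 0 := by
    intro e he
    rw [hcard e he]
    split_ifs
    · linarith [pow_nonneg hp j]
    · simp
  have hcount : ((E.filter (· ∈ F)).card : ℝ) ≤ j := by
    have : E.filter (· ∈ F) ⊆ F \ M := by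
      intro e he
      rw [Finset.mem_filter] at he
      exact Finset.mem_sdiff.2 ⟨he.2, Finset.disjoint_left.1 hE he.1⟩
    exact_mod_cast Finset.card_le_card this
  have hbern : p ^ j + j * (1 / D) * p ^ (j - 1) ≤ (p + 1 / D) ^ j := by
    have hD' : 0 ≤ 1 / D := by positivity
    clear_value j
    clear hj hcard hterm hcount
    induction j with
    | zero => simp
    | succ k ih =>
      rw [pow_succ (p + 1 / D)]
      refine le_trans ?_ (mul_le_mul_of_nonneg_right ih (by positivity))
      have h1 : p ^ (k + 1) + ((k + 1 : ℕ) : ℝ) * (1 / D) * p ^ (k + 1 - 1)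
          = p ^ k * (p + 1 / D) + k * (1 / D) * p ^ k := by
        rw [Nat.add_sub_cancel]
        push_cast
        ring
      rw [h1, add_mul]
      have h2 : (k : ℝ) * (1 / D) * p ^ k ≤ k * (1 / D) * p ^ (k - 1) * (p + 1 / D) := by
        cases k with
        | zero => simp
        | succ l =>
          rw [Nat.add_sub_cancel, pow_succ p l, mul_add, ← mul_assoc]
          have : 0 ≤ ((l + 1 : ℕ) : ℝ) * (1 / D) * p ^ l * (1 / D) := by positivity
          linarith
      linarith
  calc ∑ e ∈ E, p ^ (F \ insert e M).card
      ≤ ∑ e ∈ E, (p ^ j + if e ∈ F then p ^ (j - 1) else 0) := Finset.sum_le_sum hterm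
    _ = E.card * p ^ j + (E.filter (· ∈ F)).card * p ^ (j - 1) := by
        rw [Finset.sum_add_distrib, ← Finset.sum_filter]
        simp
    _ ≤ E.card * p ^ j + j * p ^ (j - 1) := by gcongr
    _ ≤ E.card * p ^ j + E.card * (j * (1 / D) * p ^ (j - 1)) := by
        have h1 : 1 ≤ E.card * (1 / D) := by rw [mul_one_div, le_div_iff₀ hD]; linarith
        have h2 : 0 ≤ (j : ℝ) * p ^ (j - 1) := by positivity
        nlinarith
    _ ≤ E.card * (p + 1 / D) ^ j := by rw [← mul_add]; gcongr

/-- Spending a move lowers the base by exactly 1/D, which offsets the average rise from the new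
edge. Some edge does no worse than average. -/
theorem exists_danger_insert_le (𝓕 : Finset (Finset (Sym2 V))) {D : ℝ} (hD : 0 < D) {T : ℕ}
    {E M : Finset (Sym2 V)} (hE : Disjoint E M) (hDE : D ≤ E.card) (hMT : M.card < T) :
    ∃ e ∈ E, danger 𝓕 D T (insert e M) ≤ danger 𝓕 D T M := by
  have hne : E.Nonempty := by
    rw [← Finset.card_pos]
    exact_mod_cast hD.trans_le hDE
  refine Finset.exists_le_of_sum_le hne ?_
  have hp : 0 ≤ ((T : ℝ) - (M.card + 1)) / D := by
    have : (M.card : ℝ) + 1 ≤ T := by exact_mod_cast hMT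
    exact div_nonneg (by linarith) hD.le
  have hpp : ((T : ℝ) - (M.card + 1)) / D + 1 / D = ((T : ℝ) - M.card) / D := by ring
  calc ∑ e ∈ E, danger 𝓕 D T (insert e M)
      = ∑ F ∈ 𝓕, ∑ e ∈ E, (((T : ℝ) - (M.card + 1)) / D) ^ (F \ insert e M).card := by
        rw [Finset.sum_comm]
        refine Finset.sum_congr rfl fun e he => ?_
        rw [danger, Finset.card_insert_of_notMem (Finset.disjoint_left.1 hE he)]
        push_cast
        rfl
    _ ≤ ∑ F ∈ 𝓕, E.card * (((T : ℝ) - M.card) / D) ^ (F \ M).card := by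
        refine Finset.sum_le_sum fun F _ => ?_
        rw [← hpp]
        exact sum_pow_card_sdiff_insert_le hD hp hE hDE F
    _ = ∑ e ∈ E, danger 𝓕 D T M := by
        rw [Finset.sum_const, nsmul_eq_mul, danger, Finset.mul_sum]

theorem not_subset_of_danger_lt_one {𝓕 : Finset (Finset (Sym2 V))} {D : ℝ} {T : ℕ}
    {M : Finset (Sym2 V)} (hT : M.card = T) (h : danger 𝓕 D T M < 1) :
    ∀ F ∈ 𝓕, ¬ F ⊆ M := by
  intro F hF hFM
  have h1 : (((T : ℝ) - M.card) / D) ^ (F \ M).card ≤ danger 𝓕 D T M :=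
    Finset.single_le_sum (f := fun F => (((T : ℝ) - M.card) / D) ^ (F \ M).card)
      -- With no moves left the base is 0, and `0 ^ 0 = 1` makes each owned member count 1.
      (fun G _ => by rw [hT]; simp) hF
  rw [Finset.sdiff_eq_empty_iff_subset.2 hFM] at h1
  simp only [Finset.card_empty, pow_zero] at h1
  linarith

end Potential

/-! ### Maker's strategy and its invariant. -/

section Strategy

variable {V : Type*} [Fintype V] [DecidableEq V]

theorem exists_potential_strategy [Nonempty V] (𝓕 : Finset (Finset (Sym2 V))) (D : ℝ) (T : ℕ) :
    ∃ S : Position V → Sym2 V, (∀ P : Position V, P.free.Nonempty → S P ∈ P.free) ∧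
      ∀ P : Position V, (∃ e ∈ P.free, danger 𝓕 D T (insert e P.maker) ≤ danger 𝓕 D T P.maker) →
        danger 𝓕 D T (insert (S P) P.maker) ≤ danger 𝓕 D T P.maker := by
  have h : ∀ P : Position V, ∃ e : Sym2 V, (P.free.Nonempty → e ∈ P.free) ∧
      ((∃ e ∈ P.free, danger 𝓕 D T (insert e P.maker) ≤ danger 𝓕 D T P.maker) →
        danger 𝓕 D T (insert e P.maker) ≤ danger 𝓕 D T P.maker) := by
    intro P
    by_cases h1 : ∃ e ∈ P.free, danger 𝓕 D T (insert e P.maker) ≤ danger 𝓕 D T P.maker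
    · obtain ⟨e, he, hd⟩ := h1
      exact ⟨e, fun _ => he, fun _ => hd⟩
    by_cases h2 : P.free.Nonempty
    · obtain ⟨e, he⟩ := h2
      exact ⟨e, fun _ => he, fun h => absurd h h1⟩
    · exact ⟨s(Classical.arbitrary V, Classical.arbitrary V), fun h => absurd h h2,
        fun h => absurd h h1⟩
  choose S hS using h
  exact ⟨S, fun P => (hS P).1, fun P => (hS P).2⟩

theorem Position.le_card_free (P : Position V) :
    (⊤ : SimpleGraph V).edgeFinset.card ≤ P.free.card + P.maker.card + P.breaker.card := by
  have h1 := Finset.le_card_sdiff (P.maker ∪ P.breaker) (⊤ : SimpleGraph V).edgeFinset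
  have h2 := Finset.card_union_le P.maker P.breaker
  rw [Position.free]
  omega

/-- If the expected number of members of `𝓕` in a random set of `T` edges is less than one, Maker
can claim `T` edges without owning a member of `𝓕`, provided many edges stay free that long. -/
theorem makerWins_of_sum_pow_lt_one [Nonempty V] {b T : ℕ} {D : ℝ} (hD : 0 < D)
    {𝓕 : Finset (Finset (Sym2 V))} {Q : SimpleGraph V → Prop}
    (hfree : ∀ t < T, D + (b + 1) * t ≤ (⊤ : SimpleGraph V).edgeFinset.card)
    (hsum : ∑ F ∈ 𝓕, ((T : ℝ) / D) ^ F.card < 1)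
    (hQ : ∀ M₀ M : Finset (Sym2 V), M₀.card = T → (∀ F ∈ 𝓕, ¬ F ⊆ M₀) → M₀ ⊆ M →
      Q (SimpleGraph.fromEdgeSet (M : Set (Sym2 V)))) :
    MakerWins b Q := by
  obtain ⟨S, hS1, hS2⟩ := exists_potential_strategy 𝓕 D T
  have hDfree : ∀ P : Position V, P.breaker.card ≤ b * P.maker.card → P.maker.card < T →
      D ≤ P.free.card := by
    intro P hP hT
    have h1 := hfree _ hT
    have h2 : ((⊤ : SimpleGraph V).edgeFinset.card : ℝ) ≤
        P.free.card + P.maker.card + P.breaker.card := by exact_mod_cast P.le_card_free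
    have h3 : (P.breaker.card : ℝ) ≤ b * P.maker.card := by exact_mod_cast hP
    linarith
  -- Once `T` edges are claimed, they are frozen as `M₀`; later edges cannot hurt, since `hQ` allows
  -- any superset.
  have key : ∀ P : Position V, Reachable b S P → P.breaker.card ≤ b * P.maker.card ∧
      (P.maker.card ≤ T → danger 𝓕 D T P.maker < 1) ∧
      (T ≤ P.maker.card → ∃ M₀ ⊆ P.maker, M₀.card = T ∧ ∀ F ∈ 𝓕, ¬ F ⊆ M₀) := by
    intro P hP
    induction hP with
    | initial =>
      have h0 : danger 𝓕 D T (∅ : Finset (Sym2 V)) < 1 := by simpa [danger] using hsum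
      refine ⟨by simp [Position.initial], fun _ => h0, fun hT => ⟨∅, subset_rfl, ?_, ?_⟩⟩
      · simp only [Position.initial, Finset.card_empty, Nat.le_zero] at hT
        simp [hT]
      · simp only [Position.initial, Finset.card_empty, Nat.le_zero] at hT
        exact not_subset_of_danger_lt_one (by simp [hT]) h0
    | round P R hP hne hR ih =>
      obtain ⟨ih1, ih2, ih3⟩ := ih
      have hSP := hS1 P hne
      have hdisj : Disjoint P.free P.maker := by
        rw [Finset.disjoint_left]
        intro e he heM
        simp only [Position.free, Finset.mem_sdiff, Finset.mem_union] at he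
        exact he.2 (Or.inl heM)
      have hcard : (insert (S P) P.maker).card = P.maker.card + 1 :=
        Finset.card_insert_of_notMem (Finset.disjoint_left.1 hdisj hSP)
      have hdanger : P.maker.card + 1 ≤ T → danger 𝓕 D T (insert (S P) P.maker) < 1 := fun hT =>
        (hS2 P (exists_danger_insert_le 𝓕 hD hdisj (hDfree P ih1 hT) hT)).trans_lt
          (ih2 (by omega))
      simp only [Position.makerMove, Position.breakerMove, hcard]
      refine ⟨?_, hdanger, fun hT => ?_⟩
      · have h1 := Finset.card_union_le P.breaker R
        have h2 : R.card ≤ b := hR.2.trans_le (min_le_left _ _)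
        rw [mul_add]
        omega
      · rcases hT.eq_or_lt with hT | hT
        · exact ⟨_, subset_rfl, hcard.trans hT.symm,
            not_subset_of_danger_lt_one (hcard.trans hT.symm) (hdanger hT.ge)⟩
        · obtain ⟨M₀, h1, h2⟩ := ih3 (by omega)
          exact ⟨M₀, h1.trans (Finset.subset_insert _ _), h2⟩
  refine ⟨S, fun P hP => ⟨hS1 P, fun hend => ?_⟩⟩
  obtain ⟨h1, -, h3⟩ := key P hP
  -- Before Maker has `T` edges, at least `D > 0` edges are free, so the game cannot have ended.
  have hT : T ≤ P.maker.card := by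
    by_contra! hT
    have := hDfree P h1 hT
    rw [hend] at this
    simp only [Finset.card_empty, Nat.cast_zero] at this
    linarith
  obtain ⟨M₀, hM, hc, hF⟩ := h3 hT
  exact hQ M₀ _ hc hF hM

end Strategy

/-! ### The first moment bound for dense small sets. -/

section FirstMoment

theorem choose_le_exp_mul_div_pow (N : ℕ) {r : ℕ} (hr : 1 ≤ r) :
    (N.choose r : ℝ) ≤ (Real.exp 1 * N / r) ^ r := by
  have hr' : (0 : ℝ) < r := by exact_mod_cast hr
  have h1 : (r : ℝ) ^ r / r.factorial ≤ Real.exp 1 ^ r := by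
    rw [← Real.exp_nat_mul, mul_one]
    exact Real.pow_div_factorial_le_exp _ hr'.le r
  calc (N.choose r : ℝ) ≤ (N : ℝ) ^ r / r.factorial := Nat.choose_le_pow_div r N
    _ = (N / r : ℝ) ^ r * ((r : ℝ) ^ r / r.factorial) := by
        rw [div_pow]
        field_simp
    _ ≤ (N / r : ℝ) ^ r * Real.exp 1 ^ r := by gcongr
    _ = (Real.exp 1 * N / r) ^ r := by rw [← mul_pow]; ring

/-- With y = eCs/n ≤ ρ ≤ 1, the edge factor is at most y^k ≤ y^(βs), and the choice of vertices
costs (en/s)^s. One factor y per vertex cancels en/s up to e²C; the excess y^(β-1) ≤ ρ^(β-1) makes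
the product small. The `s + 1` appears because `Finset.sym2` includes the diagonal. -/
theorem choose_mul_choose_mul_pow_le {n s k : ℕ} {x C β ρ α : ℝ} (hs : 1 ≤ s) (hx : 0 ≤ x)
    (hxC : x * n ≤ C) (hn : 0 < n) (hC : 0 < C) (hsn : (s : ℝ) ≤ α * n) (hβ : 1 ≤ β)
    (hk : β * s ≤ k) (hαρ : Real.exp 1 * C * α ≤ ρ) (hρ : ρ ≤ 1)
    (hρβ : ρ ^ (β - 1) * (Real.exp 1 ^ 2 * C) ≤ 1 / 4) :
    (n.choose s : ℝ) * (((s + 1).choose 2).choose k * x ^ k) ≤ (1 / 4) ^ s := by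
  have hs' : (1 : ℝ) ≤ s := by exact_mod_cast hs
  have hn' : (0 : ℝ) < n := by exact_mod_cast hn
  have hsk : (s : ℝ) ≤ k := le_trans (by nlinarith) hk
  have hk0 : 1 ≤ k := by exact_mod_cast hs'.trans hsk
  have hk' : (0 : ℝ) < k := by linarith
  have he : 0 < Real.exp 1 := Real.exp_pos 1
  set y : ℝ := Real.exp 1 * C * s / n with hy
  have hy0 : 0 < y := by positivity
  have hyρ : y ≤ ρ := by
    refine le_trans ?_ hαρ
    rw [hy, mul_div_assoc]
    gcongr
    rwa [div_le_iff₀ hn']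
  have hchoose : (((s + 1).choose 2 : ℕ) : ℝ) ≤ s * s := by
    rw [Nat.cast_choose_two]
    push_cast
    nlinarith
  have h1 : (((s + 1).choose 2).choose k : ℝ) * x ^ k ≤ y ^ k := by
    calc (((s + 1).choose 2).choose k : ℝ) * x ^ k
        ≤ (Real.exp 1 * ((s + 1).choose 2 : ℕ) / k) ^ k * x ^ k := by
          gcongr
          exact choose_le_exp_mul_div_pow _ hk0
      _ ≤ (Real.exp 1 * s) ^ k * (C / n) ^ k := by
          gcongr
          · rw [div_le_iff₀ hk', mul_assoc]
            gcongr
            exact hchoose.trans (by gcongr)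
          · rwa [le_div_iff₀ hn']
      _ = y ^ k := by rw [← mul_pow, hy]; ring
  have h2 : y ^ k ≤ (y * ρ ^ (β - 1)) ^ s := by
    rw [← Real.rpow_natCast y k]
    calc y ^ (k : ℝ) ≤ y ^ (β * s) := Real.rpow_le_rpow_of_exponent_ge hy0 (hyρ.trans hρ) hk
      _ = (y * y ^ (β - 1)) ^ s := by
          rw [Real.rpow_mul hy0.le, Real.rpow_natCast]
          congr 1
          rw [← Real.rpow_one_add' hy0.le (by linarith)]
          ring_nf
      _ ≤ (y * ρ ^ (β - 1)) ^ s := by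
          have := Real.rpow_le_rpow hy0.le hyρ (by linarith : 0 ≤ β - 1)
          gcongr
  calc (n.choose s : ℝ) * (((s + 1).choose 2).choose k * x ^ k)
      ≤ (Real.exp 1 * n / s) ^ s * (y * ρ ^ (β - 1)) ^ s := by
        gcongr
        · exact choose_le_exp_mul_div_pow n hs
        · exact h1.trans h2
    _ = (ρ ^ (β - 1) * (Real.exp 1 ^ 2 * C)) ^ s := by
        rw [← mul_pow, hy]
        congr 1
        field_simp
    _ ≤ (1 / 4) ^ s := by
        have : 0 < ρ := hy0.trans_le hyρ
        gcongr

/-- The sets of more than `β * |W|` pairs inside a nonempty set `W` of at most `m` vertices, of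
minimal size. -/
noncomputable def denseSets (V : Type*) [Fintype V] [DecidableEq V] (β m : ℝ) :
    Finset (Finset (Sym2 V)) :=
  (Finset.univ.filter fun W : Finset V => 1 ≤ W.card ∧ (W.card : ℝ) ≤ m).biUnion
    fun W => W.sym2.powersetCard (⌊β * W.card⌋₊ + 1)

variable {V : Type*} [Fintype V] [DecidableEq V]

theorem card_inter_sym2_le_of_denseSets {β m : ℝ} (hβ : 0 ≤ β) {M : Finset (Sym2 V)}
    (hM : ∀ F ∈ denseSets V β m, ¬ F ⊆ M) (W : Finset V) (hW : (W.card : ℝ) ≤ m) :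
    ((M ∩ W.sym2).card : ℝ) ≤ β * W.card := by
  rcases W.eq_empty_or_nonempty with rfl | hne
  · simp
  by_contra! h
  have h1 : ⌊β * W.card⌋₊ + 1 ≤ (M ∩ W.sym2).card :=
    (Nat.floor_lt (by positivity)).2 h
  obtain ⟨F, hF, hFc⟩ := Finset.exists_subset_card_eq h1
  refine hM F ?_ (hF.trans Finset.inter_subset_left)
  rw [denseSets, Finset.mem_biUnion]
  refine ⟨W, ?_, Finset.mem_powersetCard.2 ⟨hF.trans Finset.inter_subset_right, hFc⟩⟩
  simpa using ⟨hne, hW⟩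

theorem sum_biUnion_le_sum {ι κ : Type*} [DecidableEq κ] (s : Finset ι) (t : ι → Finset κ)
    {f : κ → ℝ} (hf : ∀ i, 0 ≤ f i) : ∑ j ∈ s.biUnion t, f j ≤ ∑ i ∈ s, ∑ j ∈ t i, f j := by
  classical
  induction s using Finset.induction_on with
  | empty => simp
  | insert a s ha ih =>
    rw [Finset.biUnion_insert, Finset.sum_insert ha]
    have h1 := Finset.sum_union_inter (s₁ := t a) (s₂ := s.biUnion t) (f := f)
    have h2 : 0 ≤ ∑ j ∈ t a ∩ s.biUnion t, f j := Finset.sum_nonneg fun j _ => hf j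
    linarith

theorem sum_denseSets_pow_lt_one {x C β ρ α : ℝ} (hx : 0 ≤ x)
    (hxC : x * Fintype.card V ≤ C) (hn : 0 < Fintype.card V) (hC : 0 < C) (hβ : 1 ≤ β)
    (hαρ : Real.exp 1 * C * α ≤ ρ) (hρ : ρ ≤ 1)
    (hρβ : ρ ^ (β - 1) * (Real.exp 1 ^ 2 * C) ≤ 1 / 4) :
    ∑ F ∈ denseSets V β (α * Fintype.card V), x ^ F.card < 1 := by
  classical
  set n := Fintype.card V with hndef
  set g : ℕ → ℝ := fun s => if 1 ≤ s ∧ (s : ℝ) ≤ α * n then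
    ((s + 1).choose 2).choose (⌊β * s⌋₊ + 1) * x ^ (⌊β * s⌋₊ + 1) else 0 with hg
  have h1 : ∑ F ∈ denseSets V β (α * n), x ^ F.card ≤
      ∑ W ∈ (Finset.univ : Finset V).powerset, g W.card := by
    refine (sum_biUnion_le_sum _ _ fun F => pow_nonneg hx _).trans (le_of_eq ?_)
    rw [Finset.sum_filter, Finset.powerset_univ]
    refine Finset.sum_congr rfl fun W _ => ?_
    rw [hg]
    dsimp only
    congr 1
    rw [Finset.sum_congr rfl fun F hF => by rw [(Finset.mem_powersetCard.1 hF).2],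
      Finset.sum_const, Finset.card_powersetCard, Finset.card_sym2, nsmul_eq_mul]
  -- The empty set contributes nothing, so the geometric sum starts at `s = 1` and stays below 1/3.
  have h2 : ∀ s ∈ Finset.range (n + 1), n.choose s • g s ≤ if s = 0 then 0 else (1 / 4 : ℝ) ^ s := by
    intro s _
    rw [hg, nsmul_eq_mul]
    dsimp only
    by_cases hs : 1 ≤ s ∧ (s : ℝ) ≤ α * n
    · rw [if_pos hs, if_neg (by omega)]
      refine choose_mul_choose_mul_pow_le hs.1 hx hxC hn hC hs.2 hβ ?_ hαρ hρ hρβ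
      push_cast
      exact (Nat.lt_floor_add_one _).le
    · rw [if_neg hs, mul_zero]
      split_ifs <;> positivity
  rw [Finset.sum_powerset_apply_card, Finset.card_univ, ← hndef] at h1
  refine (h1.trans (Finset.sum_le_sum h2)).trans_lt ?_
  rw [Finset.sum_range_succ']
  simp only [Nat.add_eq_zero_iff, one_ne_zero, and_false, if_false, if_true, add_zero, pow_succ]
  rw [← Finset.sum_mul, geom_sum_eq (by norm_num)]
  have : (0 : ℝ) < (1 / 4) ^ n := by positivity
  rw [div_mul_eq_mul_div, div_lt_iff_of_neg (by norm_num)]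
  linarith

end FirstMoment

/-! ### Choice of constants and conclusion. -/

theorem HasCycleOfLengthAtLeast.mono {V : Type*} {ℓ : ℝ} {G H : SimpleGraph V} (hGH : G ≤ H)
    (h : HasCycleOfLengthAtLeast ℓ G) : HasCycleOfLengthAtLeast ℓ H := by
  obtain ⟨v, p, hp, hl⟩ := h
  exact ⟨v, p.mapLe hGH, hp.mapLe hGH, by simpa using hl⟩

theorem exists_first_moment_constants {C δ : ℝ} (hC : 1 ≤ C) (hδ : 0 < δ) :
    ∃ α : ℝ, 0 < α ∧ ∃ ρ : ℝ, ρ ≤ 1 ∧ Real.exp 1 * C * α ≤ ρ ∧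
      ρ ^ δ * (Real.exp 1 ^ 2 * C) ≤ 1 / 4 := by
  have he : 1 ≤ Real.exp 1 := Real.one_le_exp zero_le_one
  obtain ⟨x, hx⟩ : ∃ x : ℝ, x = Real.exp 1 ^ 2 * C := ⟨_, rfl⟩
  have hx1 : 1 ≤ x := hx ▸ one_le_mul_of_one_le_of_one_le (one_le_pow₀ he) hC
  have hA0 : 0 < 1 / (4 * x) := by positivity
  have hA1 : 1 / (4 * x) ≤ 1 := by
    rw [div_le_one (by positivity)]
    linarith
  refine ⟨(1 / (4 * x)) ^ (1 / δ) / (Real.exp 1 * C), by positivity, (1 / (4 * x)) ^ (1 / δ),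
    Real.rpow_le_one hA0.le hA1 (by positivity), ?_, ?_⟩
  · rw [mul_div_cancel₀ _ (by positivity)]
  · rw [← hx, ← Real.rpow_mul hA0.le, one_div_mul_cancel hδ.ne', Real.rpow_one]
    exact le_of_eq (by field_simp)

end MakerBreaker

theorem mainTheorem11 :
    ∀ ε : ℝ, 0 < ε → ∃ c : ℝ, 0 < c ∧ ∃ n₀ : ℕ, ∀ n : ℕ, n₀ ≤ n →
      ∀ b : ℕ, 1 ≤ b → (b : ℝ) ≤ (1 - ε) * ((n : ℝ) / 2) →
        MakerBreaker.MakerWins (V := Fin n) b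
          (MakerBreaker.HasCycleOfLengthAtLeast (c * (n : ℝ))) := by
  intro ε₀ hε₀
  obtain ⟨ε, hε, hε1, hεε₀⟩ : ∃ ε : ℝ, 0 < ε ∧ ε ≤ 1 / 2 ∧ ε ≤ ε₀ :=
    ⟨min ε₀ (1 / 2), by positivity, min_le_right _ _, min_le_left _ _⟩
  -- From T ≤ 2n and D = εn²/8 follows T/D ≤ C/n.
  obtain ⟨C, hC⟩ : ∃ x : ℝ, x = 16 / ε := ⟨_, rfl⟩
  have hC1 : 1 ≤ C := by rw [hC, le_div_iff₀ hε]; linarith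
  obtain ⟨α, hα0, ρ, hρ1, hαρ, hρC⟩ :=
    MakerBreaker.exists_first_moment_constants hC1 (by positivity : 0 < ε / 8)
  -- Chosen so that 2cn = (ε/8)(αn/4), where ε/8 is the density gap γ - β and αn/4 ≤ s.
  obtain ⟨c, hc⟩ : ∃ x : ℝ, x = ε * α / 64 := ⟨_, rfl⟩
  have hc0 : 0 < c := by rw [hc]; positivity
  refine ⟨c, hc0, ⌈40 / ε + 8 / α + 1 / c⌉₊, fun n hn b _ hb => ?_⟩
  have hn' := (Nat.ceil_le.1 hn)
  have hp1 : 0 < 40 / ε := by positivity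
  have hp2 : 0 < 8 / α := by positivity
  have hp3 : 0 < 1 / c := by positivity
  have hnε : 40 ≤ ε * n := by
    have : 40 / ε ≤ n := by linarith
    rwa [div_le_iff₀' hε] at this
  have hnα : 8 ≤ α * n := by
    have : 8 / α ≤ n := by linarith
    rwa [div_le_iff₀' hα0] at this
  have hnc : 1 ≤ c * n := by
    have : 1 / c ≤ n := by linarith
    rwa [div_le_iff₀' hc0] at this
  have hn0 : (0 : ℝ) < n := by linarith
  have hn1 : (1 : ℝ) ≤ n := by nlinarith
  have hnpos : 0 < n := by exact_mod_cast hn0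
  have : Nonempty (Fin n) := ⟨⟨0, hnpos⟩⟩
  obtain ⟨T, hT⟩ : ∃ x : ℕ, x = ⌈(1 + ε / 2) * n⌉₊ := ⟨_, rfl⟩
  have hT1 : (1 + ε / 2) * n ≤ T := hT ▸ Nat.le_ceil _
  have hT2 : (T : ℝ) ≤ 2 * n := by
    have := (Nat.ceil_lt_add_one (by positivity : 0 ≤ (1 + ε / 2) * (n : ℝ))).le
    rw [← hT] at this
    nlinarith
  obtain ⟨s, hs⟩ : ∃ x : ℕ, x = ⌈α * n / 4⌉₊ := ⟨_, rfl⟩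
  have hs1 : α * n / 4 ≤ s := hs ▸ Nat.le_ceil _
  have hs2 : (s : ℝ) < α * n / 4 + 1 := hs ▸ Nat.ceil_lt_add_one (by positivity)
  have hD : 0 < ε * (n : ℝ) ^ 2 / 8 := by positivity
  have hcn : c * n = ε / 64 * (α * n) := by rw [hc]; ring
  have hcn' : c * n ≤ 1 / 128 * (α * n) := by
    rw [hcn]; exact mul_le_mul_of_nonneg_right (by linarith) (by linarith)
  refine MakerBreaker.makerWins_of_sum_pow_lt_one (T := T) hD
    (𝓕 := MakerBreaker.denseSets (Fin n) (1 + ε / 8) (α * n)) ?_ ?_ ?_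
  · intro t ht
    have ht' : (t : ℝ) ≤ (1 + ε / 2) * n := (Nat.lt_ceil.1 (hT ▸ ht)).le
    rw [SimpleGraph.card_edgeFinset_top_eq_card_choose_two, Fintype.card_fin, Nat.cast_choose_two]
    have hb' : (b : ℝ) + 1 ≤ (1 - ε) * (n / 2) + 1 := by
      have : (1 - ε₀) * ((n : ℝ) / 2) ≤ (1 - ε) * (n / 2) := by gcongr
      linarith
    have h1 : ((b : ℝ) + 1) * t ≤ ((1 - ε) * (n / 2) + 1) * ((1 + ε / 2) * n) :=
      mul_le_mul hb' ht' (by positivity) (by linarith [b.cast_nonneg (α := ℝ)])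
    -- Since (1 - ε)(1 + ε/2) ≤ 1 - ε/2, about εn²/4 edges remain; half of this is `D`, and the
    -- other half absorbs the linear terms because εn ≥ 40.
    nlinarith [mul_le_mul_of_nonneg_right hnε hn0.le, mul_pos hε hn0,
      mul_nonneg (sq_nonneg ε) (sq_nonneg (n : ℝ))]
  · have := MakerBreaker.sum_denseSets_pow_lt_one (V := Fin n) (x := (T : ℝ) / (ε * n ^ 2 / 8))
      (C := C) (β := 1 + ε / 8) (ρ := ρ) (α := α) (by positivity) ?_ (by simpa using hnpos)
      (by linarith) (by linarith) ?_ hρ1 ?_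
    · simpa using this
    · rw [Fintype.card_fin, hC, div_mul_eq_mul_div, div_le_div_iff₀ hD hε]
      have := mul_le_mul_of_nonneg_right hT2 (mul_pos hn0 hε).le
      linarith
    · exact hαρ
    · rwa [add_sub_cancel_left]
  · intro M₀ M hM₀ hF hM
    refine MakerBreaker.HasCycleOfLengthAtLeast.mono
      (SimpleGraph.fromEdgeSet_mono (Finset.coe_subset.2 hM)) ?_
    refine MakerBreaker.exists_cycle_of_locally_sparse (β := 1 + ε / 8) (γ := 1 + ε / 4)
      (m := α * n) (s := s) (by positivity) (by linarith)
      (MakerBreaker.card_inter_sym2_le_of_denseSets (by positivity) hF) ?_ ?_ ?_ hnc ?_ ?_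
    · rw [hs, Nat.one_le_iff_ne_zero]
      exact (Nat.ceil_pos.2 (by positivity)).ne'
    · linarith
    · linarith
    · have h1 : (1 + ε / 8) * (c * n) ≤ 2 * (c * n) := by gcongr; linarith
      have h2 : (1 + ε / 4 - (1 + ε / 8)) * (α * n / 4) ≤ (1 + ε / 4 - (1 + ε / 8)) * s := by
        have : 0 ≤ 1 + ε / 4 - (1 + ε / 8) := by linarith
        gcongr
      refine h1.trans (le_trans (le_of_eq ?_) h2)
      rw [hcn]; ring
    · rw [Fintype.card_fin, hM₀]
      nlinarith
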